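/- For a bounded real sequence $w\in\ell^\infty$ let $B_w:\ell^2\to\ell^2$ be the unilateral weighted shift $B_w(x)(i)=w(i)\,x(i+1)$ on the real Hilbert space $\ell^2$ (indices $i\in\omega=\{0,1,2,\dots\}$). Let $\mathsf{HC}(w)$ be the set of hypercyclic vectors of $B_w$, that is, the set of $x\in\ell^2$ for which $\{B_w^n(x):n\in\omega\}$ is dense in $\ell^2$. For $W\subseteq\ell^\infty$ let $\mathsf{HC}^*(W)=\bigcap_{w\in W}\mathsf{HC}(w)$. Theorem. Assume Martin's Axiom: for every nonempty partially ordered set $\mathbb P$ in which every set of pairwise incompatible elements is countable, and every collection $\mathcal D$ of dense subsets of $\mathbb P$ with $|\mathcal D|<\mathfrak c$, there is a (nonempty) filter $G\subseteq\mathbb P$ with $G\cap D\neq\emptyset$ for all $D\in\mathcal D$. (Here $p,q\in\mathbb P$ are incompatible if there is no $r\in\mathbb P$ with $r\le p$ and $r\le q$, and $D\subseteq\mathbb P$ is dense if for every $p\in\mathbb P$ there is $q\in D$ with $q\le p$.) Then there is $W\subseteq\{1,2\}^\omega$ such that $\mathsf{HC}^*(W)$ does not have the property of Baire in $\ell^2$.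 The same conclusion holds if the Continuum Hypothesis is assumed instead. It also holds under the weaker assumption that the intersection of any family of fewer than $\mathfrak c$ comeager subsets of $\ell^2$ is nonempty (equivalently, $\mathrm{cov}(\mathcal M)=\mathfrak c$). -/

import Mathlib

open scoped ENNReal Cardinal

namespace CommonHypercyclic

/-- The real Hilbert space `ℓ²` of square-summable real sequences. -/
abbrev EllTwo : Type := lp (fun _ : ℕ => ℝ) 2

/-- The space `ℓ^∞` of bounded real sequences (the weight sequences). -/
abbrev EllInfty : Type := lp (fun _ : ℕ => ℝ) ∞

theorem summable_sq (x : EllTwo) : Summable fun i => ‖x i‖ ^ 2 := by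
  have h := (lp.memℓp x).summable (by norm_num)
  simpa using h

theorem norm_sq_eq (x : EllTwo) : ‖x‖ ^ 2 = ∑' i, ‖x i‖ ^ 2 := by
  have h := lp.norm_rpow_eq_tsum (p := 2) (by norm_num) x
  simpa using h

theorem norm_shift_sq_le (w : EllInfty) (x : EllTwo) (i : ℕ) :
    ‖w i * x (i + 1)‖ ^ 2 ≤ ‖w‖ ^ 2 * ‖x (i + 1)‖ ^ 2 := by
  rw [norm_mul, mul_pow]
  gcongr
  exact lp.norm_apply_le_norm ENNReal.top_ne_zero w i

theorem summable_shift_sq (w : EllInfty) (x : EllTwo) :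
    Summable fun i => ‖w i * x (i + 1)‖ ^ 2 :=
  Summable.of_nonneg_of_le (fun _ => by positivity) (norm_shift_sq_le w x)
    (((summable_nat_add_iff 1).2 (summable_sq x)).mul_left _)

theorem memℓp_shift (w : EllInfty) (x : EllTwo) :
    Memℓp (fun i => w i * x (i + 1)) 2 := by
  apply memℓp_gen
  simpa using summable_shift_sq w x

/-- The unilateral weighted shift as a linear map: `B_w x (i) = w i * x (i + 1)`. -/
def weightedShiftLinear (w : EllInfty) : EllTwo →ₗ[ℝ] EllTwo where
  toFun x := ⟨fun i => w i * x (i + 1), memℓp_shift w x⟩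
  map_add' x y := by
    ext i
    exact mul_add (w i) (x (i + 1)) (y (i + 1))
  map_smul' c x := by
    ext i
    exact mul_left_comm (w i) c (x (i + 1))

theorem norm_weightedShiftLinear_le (w : EllInfty) (x : EllTwo) :
    ‖weightedShiftLinear w x‖ ≤ ‖w‖ * ‖x‖ := by
  apply le_of_sq_le_sq _ (by positivity)
  rw [mul_pow, norm_sq_eq, norm_sq_eq, (summable_sq x).tsum_eq_zero_add, mul_add]
  have h : ∑' i, ‖w i * x (i + 1)‖ ^ 2 ≤ ∑' i, ‖w‖ ^ 2 * ‖x (i + 1)‖ ^ 2 :=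
    (summable_shift_sq w x).tsum_le_tsum (norm_shift_sq_le w x)
      (((summable_nat_add_iff 1).2 (summable_sq x)).mul_left _)
  rw [tsum_mul_left] at h
  exact h.trans (le_add_of_nonneg_left (by positivity))

/-- The unilateral weighted shift `B_w : ℓ² → ℓ²` with bounded weight sequence `w`, a bounded
operator. -/
noncomputable def weightedShift (w : EllInfty) : EllTwo →L[ℝ] EllTwo :=
  (weightedShiftLinear w).mkContinuous ‖w‖ (norm_weightedShiftLinear_le w)

@[simp]
theorem weightedShift_apply (w : EllInfty) (x : EllTwo) (i : ℕ) :
    weightedShift w x i = w i * x (i + 1) := rfl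

/-- `HC(w)`: the vectors whose forward orbit under `B_w` is dense in `ℓ²`. -/
def HC (w : EllInfty) : Set EllTwo :=
  {x | Dense (Set.range fun n : ℕ => (weightedShift w)^[n] x)}

/-- `HC*(W)`: the vectors that are hypercyclic for `B_w` for every `w ∈ W`. -/
def HCStar (W : Set EllInfty) : Set EllTwo := ⋂ w ∈ W, HC w

/-- `{1,2}^ω`, as a subset of `ℓ^∞`. -/
def oneTwoSequences : Set EllInfty := {w | ∀ i, w i = 1 ∨ w i = 2}

section Forcing

variable {P : Type} [PartialOrder P]

/-- Two elements of a partial order are compatible if they have a common lower bound. -/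
def Compatible (p q : P) : Prop := ∃ r, r ≤ p ∧ r ≤ q

/-- Countable chain condition: every set of pairwise incompatible elements is countable. -/
def CCC (P : Type) [PartialOrder P] : Prop :=
  ∀ A : Set P, A.Pairwise (fun p q => ¬ Compatible p q) → A.Countable

/-- `D` is dense: below every element there is an element of `D`. -/
def ForcingDense (D : Set P) : Prop := ∀ p : P, ∃ q ∈ D, q ≤ p

end Forcing

/-- Martin's Axiom: in a nonempty ccc partial order, for every family of fewer than continuum many
dense sets there is a (nonempty, upward closed, downward directed) filter meeting all of them. -/
def MartinsAxiom : Prop :=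
  ∀ (P : Type) [PartialOrder P] [Nonempty P], CCC P →
    ∀ 𝒟 : Set (Set P), #𝒟 < 𝔠 → (∀ D ∈ 𝒟, ForcingDense D) →
      ∃ G : Set P, Order.IsPFilter G ∧ ∀ D ∈ 𝒟, (G ∩ D).Nonempty

/-- The Continuum Hypothesis. -/
def ContinuumHypothesis : Prop := (ℵ₁ : Cardinal.{0}) = 𝔠

/-- Fewer than continuum many comeager subsets of `ℓ²` always have nonempty intersection. -/
def ComeagerIntersection : Prop :=
  ∀ 𝒞 : Set (Set EllTwo), #𝒞 < 𝔠 → (∀ C ∈ 𝒞, C ∈ residual EllTwo) → (⋂₀ 𝒞).Nonempty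

end CommonHypercyclic

namespace CommonHypercyclic

open Filter Topology Set

/-! To each `y` one attaches a weight `w_y = weightOf (avoidSet y)` in `{1,2}^ω` for which `y` is
not hypercyclic: the weights are chosen recursively so that the first coordinate of the orbit of `y`
never enters `[1, 2)` after time zero. This self-defeating choice is otherwise flexible. A tiny
negative coordinate of `y` forces weight 2 and a tiny positive one forces weight 1, so every initial
pattern coming from an open set extends arbitrarily within that set (`exists_continuation`). Hence a
fixed `x` that is hypercyclic for all eventually-2 weights is hypercyclic for `w_y` for generic `y`
(`residual_mem_HC_avoidSet`). For weights in `{1,2}^ω`, one hypercyclic vector already makes `HC`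
comeager, so `HC(w_y)` is comeager for generic `y`.

The relation `x ∈ HC(w_y)` is thus generic in each variable separately but fails on the diagonal. A
Bernstein-type recursion over the at most `𝔠` locally comeager Borel sets `t` picks `x_t, y_t ∈ t`
with `x_s ∈ HC(w_{y_t})` for all `s, t`. With `W = {w_{y_t}}`, the set `HC*(W)` contains every `x_t`
and no `y_t`, which rules out the property of Baire. Each stage needs fewer than `𝔠` comeager sets
to meet in a dense set. -/

theorem tendsto_truncation (x : EllTwo) :
    Tendsto (fun n => ∑ i ∈ Finset.range n, lp.single 2 i (x i) : ℕ → EllTwo) atTop (𝓝 x) :=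
  (lp.hasSum_single (by norm_num) x).tendsto_sum_nat

instance separableSpace_ellTwo : TopologicalSpace.SeparableSpace EllTwo := by
  have hc : (range fun i : ℕ => (lp.single 2 i (1 : ℝ) : EllTwo)).Countable := countable_range _
  have hs := (hc.isSeparable.span (R := ℝ)).closure
  rw [← TopologicalSpace.isSeparable_univ_iff]
  refine hs.mono fun x _ => mem_closure_of_tendsto (tendsto_truncation x)
    (Eventually.of_forall fun n => Submodule.sum_mem _ fun i _ => ?_)
  have : (lp.single 2 i (x i) : EllTwo) = x i • lp.single 2 i (1 : ℝ) := by
    rw [← lp.single_smul]; simp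
  rw [this]
  exact Submodule.smul_mem _ _ (Submodule.subset_span ⟨i, rfl⟩)

instance secondCountableTopology_ellTwo : SecondCountableTopology EllTwo :=
  UniformSpace.secondCountable_of_separable EllTwo

theorem coe_sum_single (f : ℕ → ℝ) (s : Finset ℕ) (j : ℕ) :
    (∑ i ∈ s, lp.single 2 i (f i) : EllTwo) j = if j ∈ s then f j else 0 := by
  rw [lp.coeFn_sum, Finset.sum_apply]
  simp only [lp.coeFn_single, Finset.sum_pi_single]

theorem iterate_weightedShift_apply (w : EllInfty) (x : EllTwo) (n i : ℕ) :
    ((weightedShift w)^[n] x) i = (∏ k ∈ Finset.range n, w (i + k)) * x (i + n) := by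
  induction n generalizing i with
  | zero => simp
  | succ n ih =>
    rw [Function.iterate_succ_apply', weightedShift_apply, ih, Finset.prod_range_succ']
    simp only [add_zero, add_assoc, add_comm 1]
    ring

theorem continuous_iterate_weightedShift (w : EllInfty) (n : ℕ) :
    Continuous fun x : EllTwo => (weightedShift w)^[n] x :=
  (weightedShift w).continuous.iterate n

/-- `HC(w)` consists of the vectors whose orbit meets every basic open set. -/
theorem HC_eq_biInter (w : EllInfty) :
    HC w = ⋂ V ∈ TopologicalSpace.countableBasis EllTwo,
      {x | ∃ n : ℕ, (weightedShift w)^[n] x ∈ V} := by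
  ext x
  simp only [HC, mem_ofPred_eq, mem_iInter]
  rw [(TopologicalSpace.isBasis_countableBasis EllTwo).dense_iff]
  refine forall₂_congr fun V hV => ?_
  have hne := TopologicalSpace.nonempty_of_mem_countableBasis hV
  simp only [hne, forall_const]
  constructor
  · rintro ⟨_, h, n, rfl⟩
    exact ⟨n, h⟩
  · rintro ⟨n, h⟩
    exact ⟨_, h, n, rfl⟩

/-- Topological transitivity implies that hypercyclic vectors are generic. -/
theorem HC_mem_residual_of_transitive (w : EllInfty)
    (h : ∀ U V : Set EllTwo, IsOpen U → IsOpen V → U.Nonempty → V.Nonempty →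
      ∃ x ∈ U, ∃ n : ℕ, (weightedShift w)^[n] x ∈ V) : HC w ∈ residual EllTwo := by
  rw [HC_eq_biInter]
  refine (countable_bInter_mem (TopologicalSpace.countable_countableBasis EllTwo)).2 fun V hV => ?_
  have hVo := TopologicalSpace.isOpen_of_mem_countableBasis hV
  have hVn := TopologicalSpace.nonempty_of_mem_countableBasis hV
  apply residual_of_dense_open
  · simp only [ofPred_exists]
    exact isOpen_iUnion fun n => hVo.preimage (continuous_iterate_weightedShift w n)
  · rw [dense_iff_inter_open]
    intro U hU hUn
    obtain ⟨x, hx, n, hn⟩ := h U V hU hVo hUn hVn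
    exact ⟨x, hx, n, hn⟩

/-! ### Weights in `{1,2}^ω`: hypercyclicity through partial products -/

open Classical in
/-- The weight sequence with value `2` on `A` and `1` off `A`. -/
noncomputable def weightOf (A : Set ℕ) : EllInfty :=
  ⟨fun i => if i ∈ A then 2 else 1, memℓp_infty ⟨2, by
    rintro _ ⟨i, rfl⟩
    dsimp only
    split_ifs <;> norm_num⟩⟩

open Classical in
theorem weightOf_apply (A : Set ℕ) (i : ℕ) : weightOf A i = if i ∈ A then 2 else 1 := rfl

theorem weightOf_mem_oneTwoSequences (A : Set ℕ) : weightOf A ∈ oneTwoSequences := fun i => by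
  rw [weightOf_apply]
  split_ifs <;> simp

theorem one_le_weightOf (A : Set ℕ) (i : ℕ) : 1 ≤ weightOf A i := by
  rw [weightOf_apply]
  split_ifs <;> norm_num

theorem norm_weightOf_le (A : Set ℕ) : ‖weightOf A‖ ≤ 2 :=
  lp.norm_le_of_forall_le (by norm_num) fun i => by
    rw [weightOf_apply]
    split_ifs <;> norm_num

theorem weightOf_eq {A B : Set ℕ} {i : ℕ} (h : i ∈ A ↔ i ∈ B) : weightOf A i = weightOf B i := by
  by_cases hA : i ∈ A
  · rw [weightOf_apply, weightOf_apply, if_pos hA, if_pos (h.1 hA)]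
  · rw [weightOf_apply, weightOf_apply, if_neg hA, if_neg (mt h.2 hA)]

/-- The partial products of the weights. -/
noncomputable def partialProd (A : Set ℕ) (n : ℕ) : ℝ := ∏ k ∈ Finset.range n, weightOf A k

theorem one_le_partialProd (A : Set ℕ) (n : ℕ) : 1 ≤ partialProd A n := by
  induction n with
  | zero => simp [partialProd]
  | succ n ih =>
    rw [partialProd, Finset.prod_range_succ]
    exact one_le_mul_of_one_le_of_one_le ih (one_le_weightOf A n)

theorem monotone_partialProd (A : Set ℕ) : Monotone (partialProd A) :=
  monotone_nat_of_le_succ fun n => by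
    rw [partialProd, partialProd, Finset.prod_range_succ]
    exact le_mul_of_one_le_right (zero_le_one.trans (one_le_partialProd A n)) (one_le_weightOf A n)

theorem prod_weightOf_add (A : Set ℕ) (i n : ℕ) :
    ∏ k ∈ Finset.range n, weightOf A (i + k) = partialProd A (i + n) / partialProd A i := by
  rw [eq_div_iff (by linarith [one_le_partialProd A i]), partialProd, partialProd,
    Finset.prod_range_add, mul_comm]

/-- Transitivity: a finitely supported `u` near `x` is eventually annihilated by the iterates, while
a finitely supported target near `z` has `n`-th preimages `S n` tending to 0, since the weight
products in the denominators diverge. So `u + S n` starts in `U` and lands in `V`. -/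
theorem HC_weightOf_mem_residual {A : Set ℕ} (hA : Tendsto (partialProd A) atTop atTop) :
    HC (weightOf A) ∈ residual EllTwo := by
  apply HC_mem_residual_of_transitive
  rintro U V hU hV ⟨x, hx⟩ ⟨z, hz⟩
  obtain ⟨m, hm⟩ := ((tendsto_truncation x).eventually (hU.mem_nhds hx)).exists
  obtain ⟨k, hk⟩ := ((tendsto_truncation z).eventually (hV.mem_nhds hz)).exists
  set u : EllTwo := ∑ i ∈ Finset.range m, lp.single 2 i (x i) with hu
  let S : ℕ → EllTwo := fun n => ∑ i ∈ Finset.range k,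
    lp.single 2 (i + n) (z i / ∏ l ∈ Finset.range n, weightOf A (i + l))
  have hS : Tendsto S atTop (𝓝 0) := by
    rw [← Finset.sum_const_zero (s := Finset.range k)]
    refine tendsto_finsetSum _ fun i _ => ?_
    rw [tendsto_zero_iff_norm_tendsto_zero]
    simp only [lp.norm_single (p := 2) (by norm_num : (0 : ℝ≥0∞) < 2)]
    rw [← tendsto_zero_iff_norm_tendsto_zero]
    refine tendsto_const_nhds.div_atTop ?_
    simp only [prod_weightOf_add]
    refine Tendsto.atTop_div_const (by linarith [one_le_partialProd A i]) ?_
    simpa only [add_comm] using (tendsto_add_atTop_iff_nat i).2 hA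
  have hSu : Tendsto (fun n => u + S n) atTop (𝓝 u) := by simpa using hS.const_add u
  obtain ⟨n, hn, hmn⟩ := ((hSu.eventually (hU.mem_nhds hm)).and (eventually_ge_atTop m)).exists
  refine ⟨_, hn, n, ?_⟩
  suffices h : (weightedShift (weightOf A))^[n] (u + S n) =
      ∑ i ∈ Finset.range k, lp.single 2 i (z i) from h ▸ hk
  ext j
  rw [iterate_weightedShift_apply, coe_sum_single, lp.coeFn_add, Pi.add_apply, hu, coe_sum_single,
    if_neg (by simp; omega), zero_add]
  have h1 : (S n) (j + n) = if j ∈ Finset.range k then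
      z j / ∏ l ∈ Finset.range n, weightOf A (j + l) else 0 := by
    simp only [S]
    rw [lp.coeFn_sum, Finset.sum_apply]
    simp only [lp.coeFn_single, Pi.single_apply, add_left_inj]
    rw [Finset.sum_ite_eq]
  rw [h1]
  split_ifs
  · refine mul_div_cancel₀ _ (Finset.prod_ne_zero_iff.2 fun l _ => ?_)
    linarith [one_le_weightOf A (j + l)]
  · simp

/-- If the products were bounded by `C`, the first coordinate of the orbit could never exceed `C *
‖x‖`. -/
theorem tendsto_partialProd_of_mem_HC {A : Set ℕ} {x : EllTwo} (hx : x ∈ HC (weightOf A)) :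
    Tendsto (partialProd A) atTop atTop := by
  refine tendsto_atTop_atTop_of_monotone (monotone_partialProd A) fun C => ?_
  by_contra! hC
  have hopen : IsOpen {v : EllTwo | C * ‖x‖ < v 0} :=
    isOpen_lt continuous_const ((lp.evalCLM ℝ (fun _ : ℕ => ℝ) 2 0).continuous)
  obtain ⟨_, ⟨n, rfl⟩, hv⟩ := hx.exists_mem_open hopen
    ⟨lp.single 2 0 (C * ‖x‖ + 1), by simp⟩
  simp only [mem_ofPred_eq, iterate_weightedShift_apply, zero_add] at hv
  have h1 : x n ≤ ‖x‖ := (le_abs_self _).trans (lp.norm_apply_le_norm (by norm_num) x n)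
  have h2 := one_le_partialProd A n
  have h3 : partialProd A n * x n ≤ partialProd A n * ‖x‖ := by gcongr
  have h4 : partialProd A n * ‖x‖ ≤ C * ‖x‖ := by
    gcongr
    exact (hC n).le
  rw [partialProd] at *
  linarith

theorem HC_weightOf_mem_residual_of_nonempty {A : Set ℕ} (h : (HC (weightOf A)).Nonempty) :
    HC (weightOf A) ∈ residual EllTwo :=
  HC_weightOf_mem_residual (tendsto_partialProd_of_mem_HC h.some_mem)

theorem tendsto_partialProd_compl_finset (A : Finset ℕ) :
    Tendsto (partialProd (A : Set ℕ)ᶜ) atTop atTop := by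
  obtain ⟨N, hN⟩ := A.exists_nat_subset_range
  have h (n : ℕ) : partialProd (A : Set ℕ)ᶜ (n + N) =
      partialProd (A : Set ℕ)ᶜ N * 2 ^ n := by
    rw [add_comm, partialProd, Finset.prod_range_add, partialProd]
    congr 1
    rw [Finset.prod_eq_pow_card (b := 2), Finset.card_range]
    intro k _
    rw [weightOf_apply, if_pos]
    intro hk
    have := Finset.mem_range.1 (hN hk)
    omega
  rw [← tendsto_add_atTop_iff_nat N]
  simp only [h]
  exact (tendsto_pow_atTop_atTop_of_one_lt one_lt_two).const_mul_atTop
    (by linarith [one_le_partialProd (A : Set ℕ)ᶜ N])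

theorem norm_iterate_weightedShift_weightOf_le (A : Set ℕ) (n : ℕ) (x : EllTwo) :
    ‖(weightedShift (weightOf A))^[n] x‖ ≤ 2 ^ n * ‖x‖ := by
  induction n with
  | zero => simp
  | succ n ih =>
    rw [Function.iterate_succ_apply']
    calc _ ≤ ‖weightOf A‖ * ‖(weightedShift (weightOf A))^[n] x‖ :=
          norm_weightedShiftLinear_le _ _
      _ ≤ 2 * (2 ^ n * ‖x‖) := by
          gcongr
          exact norm_weightOf_le A
      _ = _ := by ring

/-- The iterate `B_w^n x` depends continuously on `w ∈ {1,2}^ω`. -/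
theorem exists_forall_iterate_mem {A : Set ℕ} {x : EllTwo} {n : ℕ} {V : Set EllTwo}
    (hV : IsOpen V) (h : (weightedShift (weightOf A))^[n] x ∈ V) :
    ∃ M, ∀ B : Set ℕ, (∀ i < M, i ∈ B ↔ i ∈ A) → (weightedShift (weightOf B))^[n] x ∈ V := by
  obtain ⟨ε, hε, hball⟩ := Metric.isOpen_iff.1 hV _ h
  -- The tail of `x` contributes an error under both weights, each amplified by at most `2 ^ n`; the
  -- truncation itself sees only weights below `M`.
  have ht : Tendsto (fun m => 2 * (2 ^ n * ‖x - ∑ i ∈ Finset.range m, lp.single 2 i (x i)‖))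
      atTop (𝓝 (2 * (2 ^ n * ‖x - x‖))) :=
    ((tendsto_truncation x).const_sub x).norm.const_mul _ |>.const_mul _
  rw [sub_self, norm_zero, mul_zero, mul_zero] at ht
  obtain ⟨M, hM⟩ := (ht.eventually (gt_mem_nhds hε)).exists
  refine ⟨M, fun B hB => hball ?_⟩
  set t : EllTwo := ∑ i ∈ Finset.range M, lp.single 2 i (x i) with htdef
  have heq : (weightedShift (weightOf B))^[n] t = (weightedShift (weightOf A))^[n] t := by
    ext j
    rw [iterate_weightedShift_apply, iterate_weightedShift_apply, htdef, coe_sum_single]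
    split_ifs with hj
    · congr 1
      refine Finset.prod_congr rfl fun k hk => weightOf_eq (hB _ ?_)
      rw [Finset.mem_range] at hj hk
      omega
    · simp
  have hA := norm_iterate_weightedShift_weightOf_le A n (x - t)
  have hB' := norm_iterate_weightedShift_weightOf_le B n (x - t)
  rw [iterate_map_sub] at hA hB'
  rw [heq] at hB'
  rw [Metric.mem_ball, dist_eq_norm]
  calc _ = ‖((weightedShift (weightOf B))^[n] x - (weightedShift (weightOf A))^[n] t) -
        ((weightedShift (weightOf A))^[n] x - (weightedShift (weightOf A))^[n] t)‖ := by
        congr 1; abel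
    _ ≤ _ := norm_sub_le _ _
    _ < ε := by linarith

/-! ### The weight attached to a vector -/

open Classical in
/-- The partial products of the weight sequence attached to `y`: a weight is `2` if the next
coordinate of `y` is negative or would otherwise be scaled into `[1, 2)`. -/
noncomputable def avoidProd (y : EllTwo) : ℕ → ℕ
  | 0 => 1
  | n + 1 => if y (n + 1) < 0 ∨ 1 ≤ avoidProd y n * y (n + 1) then 2 * avoidProd y n
      else avoidProd y n

/-- The positions where the weight sequence attached to `y` has value `2`. -/
def avoidSet (y : EllTwo) : Set ℕ := {n | y (n + 1) < 0 ∨ 1 ≤ avoidProd y n * y (n + 1)}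

theorem mem_avoidSet {y : EllTwo} {n : ℕ} :
    n ∈ avoidSet y ↔ y (n + 1) < 0 ∨ 1 ≤ avoidProd y n * y (n + 1) := Iff.rfl

open Classical in
theorem avoidProd_succ (y : EllTwo) (n : ℕ) :
    avoidProd y (n + 1) = if n ∈ avoidSet y then 2 * avoidProd y n else avoidProd y n := by
  rw [avoidProd]
  simp only [mem_avoidSet]

theorem partialProd_avoidSet (y : EllTwo) (n : ℕ) : partialProd (avoidSet y) n = avoidProd y n := by
  induction n with
  | zero => simp [partialProd, avoidProd]
  | succ n ih =>
    rw [partialProd, Finset.prod_range_succ, ← partialProd, ih, weightOf_apply, avoidProd_succ]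
    split_ifs <;> push_cast <;> ring

theorem avoidProd_pos (y : EllTwo) (n : ℕ) : 0 < avoidProd y n := by
  have := one_le_partialProd (avoidSet y) n
  rw [partialProd_avoidSet] at this
  exact_mod_cast this

theorem avoidProd_le (y : EllTwo) (n : ℕ) : avoidProd y n ≤ 2 ^ n := by
  induction n with
  | zero => simp [avoidProd]
  | succ n ih =>
    rw [avoidProd_succ, pow_succ]
    split_ifs <;> omega

/-- The first coordinate of the orbit of `y` avoids the interval `[1, 2)` from time one on. -/
theorem avoidProd_mul_notMem_Ico (y : EllTwo) (n : ℕ) :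
    (avoidProd y (n + 1) * y (n + 1) : ℝ) ∉ Ico (1 : ℝ) 2 := by
  rw [avoidProd_succ]
  have hp : (0 : ℝ) < avoidProd y n := by exact_mod_cast avoidProd_pos y n
  rintro ⟨h1, h2⟩
  split_ifs at h1 h2 with h
  · push_cast at h1 h2
    rcases h with h | h
    · nlinarith
    · linarith
  · exact h (Or.inr h1)

theorem notMem_HC_avoidSet (y : EllTwo) : y ∉ HC (weightOf (avoidSet y)) := by
  intro hy
  have hc : Continuous fun v : EllTwo => v 0 := (lp.evalCLM ℝ (fun _ : ℕ => ℝ) 2 0).continuous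
  -- Removing `y 0` excludes time zero, when the first coordinate may lie in the interval.
  have hopen : IsOpen {v : EllTwo | v 0 ∈ Ioo (1 : ℝ) 2 \ {y 0}} :=
    (isOpen_Ioo.sdiff isClosed_singleton).preimage hc
  obtain ⟨c, hc1, hc2⟩ : ((Ioo (1 : ℝ) 2) \ {y 0}).Nonempty :=
    ((Ioo_infinite (by norm_num)).sdiff (finite_singleton _)).nonempty
  obtain ⟨_, ⟨n, rfl⟩, hv, hv'⟩ := hy.exists_mem_open hopen
    ⟨lp.single 2 0 c, by simpa using ⟨hc1, hc2⟩⟩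
  rw [iterate_weightedShift_apply] at hv hv'
  simp only [zero_add] at hv hv'
  rw [← partialProd, partialProd_avoidSet] at hv hv'
  cases n with
  | zero => simp [avoidProd] at hv'
  | succ n => exact avoidProd_mul_notMem_Ico y n ⟨hv.1.le, hv.2⟩

/-! ### Local constancy and genericity of the attached weight -/

theorem avoidProd_congr {y z : EllTwo} {N : ℕ} (h : ∀ i ≤ N, y i = z i) :
    avoidProd y N = avoidProd z N := by
  induction N with
  | zero => rfl
  | succ N ih => rw [avoidProd, avoidProd, ih fun i hi => h i (by omega), h _ le_rfl]

theorem mem_avoidSet_congr {y z : EllTwo} {n : ℕ} (h : ∀ i ≤ n + 1, y i = z i) :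
    n ∈ avoidSet y ↔ n ∈ avoidSet z := by
  rw [mem_avoidSet, mem_avoidSet, avoidProd_congr fun i hi => h i (by omega), h _ le_rfl]

/-- Away from the discontinuities, an initial segment of `avoidSet` is locally constant. -/
theorem eventually_avoidSet_eq {y : EllTwo} {M : ℕ}
    (hy : ∀ i < M, y (i + 1) ≠ 0 ∧ (avoidProd y i * y (i + 1) : ℝ) ≠ 1) :
    ∀ᶠ z in 𝓝 y, avoidProd z M = avoidProd y M ∧ ∀ i < M, i ∈ avoidSet z ↔ i ∈ avoidSet y := by
  induction M with
  | zero => simp [avoidProd]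
  | succ M ih =>
    have hc : Continuous fun v : EllTwo => v (M + 1) :=
      (lp.evalCLM ℝ (fun _ : ℕ => ℝ) 2 (M + 1)).continuous
    have h0 : ∀ᶠ z : EllTwo in 𝓝 y, z (M + 1) < 0 ↔ y (M + 1) < 0 := by
      rcases (hy M (by omega)).1.lt_or_gt with h | h
      · filter_upwards [hc.continuousAt.eventually_lt_const h] with z hz
        exact iff_of_true hz h
      · filter_upwards [hc.continuousAt.eventually_const_lt h] with z hz
        exact iff_of_false hz.not_gt h.not_gt
    have h1 : ∀ᶠ z : EllTwo in 𝓝 y,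
        1 ≤ avoidProd y M * z (M + 1) ↔ 1 ≤ avoidProd y M * y (M + 1) := by
      have hc' : Continuous fun v : EllTwo => (avoidProd y M * v (M + 1) : ℝ) := hc.const_mul _
      rcases (hy M (by omega)).2.lt_or_gt with h | h
      · filter_upwards [hc'.continuousAt.eventually_lt_const h] with z hz
        exact iff_of_false hz.not_ge h.not_ge
      · filter_upwards [hc'.continuousAt.eventually_const_lt h] with z hz
        exact iff_of_true hz.le h.le
    filter_upwards [ih fun i hi => hy i (by omega), h0, h1] with z hz hz0 hz1
    have hM : M ∈ avoidSet z ↔ M ∈ avoidSet y := by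
      rw [mem_avoidSet, mem_avoidSet, hz.1, hz0, hz1]
    refine ⟨?_, fun i hi => ?_⟩
    · rw [avoidProd_succ, avoidProd_succ, hz.1]
      by_cases h : M ∈ avoidSet y
      · rw [if_pos h, if_pos (hM.2 h)]
      · rw [if_neg h, if_neg (mt hM.1 h)]
    · rcases Nat.lt_succ_iff_lt_or_eq.1 hi with h | rfl
      exacts [hz.2 i h, hM]

/-- Irrational coordinates avoid the thresholds 0 and 1 at which `avoidSet` may jump. Coordinate
evaluations are open maps, so they pull comeager sets back to comeager sets. -/
theorem residual_irrational_coord : {y : EllTwo | ∀ i, Irrational (y i)} ∈ residual EllTwo := by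
  rw [ofPred_forall, countable_iInter_mem]
  intro i
  have ho : IsOpenMap (lp.evalCLM ℝ (fun _ : ℕ => ℝ) 2 i) :=
    ContinuousLinearMap.isOpenMap _ fun c => ⟨lp.single 2 i c, lp.single_apply_self (E := fun _ : ℕ => ℝ) 2 i c⟩
  exact tendsto_residual_of_isOpenMap (ContinuousLinearMap.continuous _) ho
    eventually_residual_irrational

/-- In every nonempty open set, some initial segment of `avoidSet y` can be continued at will, in
such a way that it is locally constant at `y`. -/
theorem exists_continuation {U : Set EllTwo} (hU : IsOpen U) (hUn : U.Nonempty) :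
    ∃ (N : ℕ) (A₀ : Set ℕ), ∀ A : Set ℕ, (∀ i < N, i ∈ A ↔ i ∈ A₀) → ∀ M, N ≤ M →
      ∃ y ∈ U, ∀ᶠ z in 𝓝 y, ∀ i < M, i ∈ avoidSet z ↔ i ∈ A := by
  obtain ⟨y, hyU, hy⟩ :=
    (dense_of_mem_residual residual_irrational_coord).inter_open_nonempty U hU hUn
  obtain ⟨N, hN⟩ := (((tendsto_add_atTop_iff_nat 1).2 (tendsto_truncation y)).eventually
    (hU.mem_nhds hyU)).exists
  refine ⟨N, avoidSet y, fun A hA M hNM => ?_⟩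
  classical
  -- Weight `i - 1` acts on coordinate `i`, whose sign encodes the desired weight. As `avoidProd` is
  -- at most `2 ^ (i - 1)` there, the size `c / 2 ^ i` keeps the product below 1, so the sign alone
  -- decides.
  let g : ℕ → ℝ := fun i => if i ≤ N then 0 else (if i - 1 ∈ A then -1 else 1) / 2 ^ i
  let Y : ℝ → EllTwo := fun c => ∑ i ∈ Finset.range (N + 1), lp.single 2 i (y i) +
    c • ∑ i ∈ Finset.range (M + 1), lp.single 2 i (g i)
  have hYc : Continuous Y := continuous_const.add (continuous_id.smul continuous_const)
  have hY0 : Y 0 ∈ U := by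
    simp only [Y, zero_smul, add_zero]
    exact hN
  obtain ⟨c, hcU, hc0, hc1⟩ : ∃ c, Y c ∈ U ∧ 0 < c ∧ c < 1 := by
    have h1 : ∀ᶠ c in 𝓝[>] (0 : ℝ), Y c ∈ U :=
      (hYc.continuousAt.eventually (hU.mem_nhds hY0)).filter_mono nhdsWithin_le_nhds
    exact (h1.and (Ioo_mem_nhdsGT one_pos)).exists
  have hlow (i : ℕ) (hi : i ≤ N) : (Y c) i = y i := by
    simp only [Y]
    rw [lp.coeFn_add, Pi.add_apply, lp.coeFn_smul, Pi.smul_apply, coe_sum_single, coe_sum_single,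
      if_pos (by simp; omega), if_pos (by simp; omega)]
    simp [g, hi]
  have hhigh (i : ℕ) (hi : N ≤ i) (hiM : i < M) :
      (Y c) (i + 1) = c * ((if i ∈ A then -1 else 1) / 2 ^ (i + 1)) := by
    simp only [Y]
    rw [lp.coeFn_add, Pi.add_apply, lp.coeFn_smul, Pi.smul_apply, coe_sum_single, coe_sum_single,
      if_neg (by simp; omega), if_pos (by simp; omega)]
    simp only [g]
    rw [if_neg (by omega)]
    simp
  have hpow (i : ℕ) : (0 : ℝ) < c / 2 ^ (i + 1) := by positivity
  have hsmall (i : ℕ) : (avoidProd (Y c) i : ℝ) * (c / 2 ^ (i + 1)) < 1 := by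
    have h1 : (avoidProd (Y c) i : ℝ) ≤ 2 ^ i := by exact_mod_cast avoidProd_le (Y c) i
    calc (avoidProd (Y c) i : ℝ) * (c / 2 ^ (i + 1)) ≤ 2 ^ i * (c / 2 ^ (i + 1)) := by
          gcongr
      _ = c / 2 := by field_simp; ring
      _ < 1 := by linarith
  have key (i : ℕ) (hi : i < M) : ((Y c) (i + 1) ≠ 0 ∧
      (avoidProd (Y c) i * (Y c) (i + 1) : ℝ) ≠ 1) ∧ (i ∈ avoidSet (Y c) ↔ i ∈ A) := by
    rcases lt_or_ge i N with h | h
    · have h1 : ∀ j ≤ i + 1, (Y c) j = y j := fun j hj => hlow j (by omega)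
      rw [mem_avoidSet_congr h1, hA i h, avoidProd_congr fun j hj => h1 j (by omega),
        h1 _ le_rfl]
      exact ⟨⟨(hy _).ne_zero, ((hy _).natCast_mul (avoidProd_pos y i).ne').ne_one⟩, Iff.rfl⟩
    · have hp : (0 : ℝ) < avoidProd (Y c) i := by exact_mod_cast avoidProd_pos (Y c) i
      rw [mem_avoidSet, hhigh i h hi]
      split_ifs with hiA
      · have h2 : c * (-1 / 2 ^ (i + 1)) < 0 := by
          have := hpow i
          rw [show c * (-1 / 2 ^ (i + 1)) = -(c / 2 ^ (i + 1)) by ring]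
          linarith
        exact ⟨⟨h2.ne, by nlinarith⟩, by simp [h2, hiA]⟩
      · rw [mul_one_div]
        exact ⟨⟨(hpow i).ne', (hsmall i).ne⟩, by simp [(hpow i).le, hsmall i, hiA]⟩
  refine ⟨Y c, hcU, ?_⟩
  filter_upwards [eventually_avoidSet_eq fun i hi => (key i hi).1] with z hz i hi
  rw [hz.2 i hi, (key i hi).2]

/-- If `x` is hypercyclic for all weights in `{1,2}^ω` that are eventually `2`, then it is
hypercyclic for the weight sequence attached to a generic `y`. -/
theorem residual_mem_HC_avoidSet {x : EllTwo}
    (hx : ∀ A : Finset ℕ, x ∈ HC (weightOf (A : Set ℕ)ᶜ)) :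
    {y : EllTwo | x ∈ HC (weightOf (avoidSet y))} ∈ residual EllTwo := by
  simp only [HC_eq_biInter, mem_iInter, mem_ofPred_eq]
  refine (eventually_countable_ball (TopologicalSpace.countable_countableBasis EllTwo)).2 ?_
  intro V hV
  have hVo := TopologicalSpace.isOpen_of_mem_countableBasis hV
  have hVn := TopologicalSpace.nonempty_of_mem_countableBasis hV
  refine mem_of_superset (residual_of_dense_open isOpen_interior ?_) interior_subset
  rw [dense_iff_inter_open]
  intro U hU hUn
  obtain ⟨N, A₀, h⟩ := exists_continuation hU hUn
  classical
  -- The complement of `F` agrees with `A₀` below `N` and is full from `N` on, so the hypothesis on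
  -- `x` applies to it.
  set F := (Finset.range N).filter (· ∉ A₀)
  obtain ⟨_, ⟨n, rfl⟩, hn⟩ := (hx F).exists_mem_open hVo hVn
  obtain ⟨M, hM⟩ := exists_forall_iterate_mem hVo hn
  obtain ⟨y, hyU, hy⟩ := h (F : Set ℕ)ᶜ (fun i hi => by simp [F, hi]) (max M N) (le_max_right _ _)
  refine ⟨y, hyU, mem_interior_iff_mem_nhds.2 ?_⟩
  filter_upwards [hy] with z hz
  exact ⟨n, hM _ fun i hi => hz i (hi.trans_le (le_max_left _ _))⟩

/-! ### Intersections of comeager sets under CH and MA -/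

theorem comeagerIntersection_of_continuumHypothesis (h : ContinuumHypothesis) :
    ComeagerIntersection := by
  intro 𝒞 hcard hres
  have hc : 𝒞.Countable := by
    rw [← Cardinal.le_aleph0_iff_set_countable, ← Cardinal.lt_aleph_one_iff]
    exact hcard.trans_eq h.symm
  exact (dense_of_mem_residual ((countable_sInter_mem hc).2 hres)).nonempty

/-- The partial order of nonempty open subsets of `ℓ²`. -/
abbrev NonemptyOpens : Type := {U : TopologicalSpace.Opens EllTwo // (U : Set EllTwo).Nonempty}

theorem compatible_of_inter_nonempty {U V : NonemptyOpens}
    (h : ((U.1 : Set EllTwo) ∩ V.1).Nonempty) : Compatible U V :=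
  ⟨⟨U.1 ⊓ V.1, h⟩, inf_le_left (a := U.1), inf_le_right (a := U.1)⟩

theorem ccc_nonemptyOpens : CCC NonemptyOpens := by
  intro A hA
  refine Set.PairwiseDisjoint.countable_of_isOpen (s := fun U : NonemptyOpens => (U.1 : Set EllTwo))
    (fun U hU V hV hne => ?_) (fun U _ => U.1.isOpen) fun U _ => U.2
  exact disjoint_iff_inter_eq_empty.2
    (not_nonempty_iff_eq_empty.1 fun h => hA hU hV hne (compatible_of_inter_nonempty h))

/-- The nonempty open sets whose closure is inside `O`. -/
def closureInside (O : Set EllTwo) : Set NonemptyOpens := {U | closure (U.1 : Set EllTwo) ⊆ O}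

/-- The nonempty open sets inside a ball of radius `1 / (n + 1)`. -/
def smallOpens (n : ℕ) : Set NonemptyOpens :=
  {U | ∃ x, (U.1 : Set EllTwo) ⊆ Metric.ball x (1 / (n + 1))}

theorem forcingDense_closureInside {O : Set EllTwo} (ho : IsOpen O) (hd : Dense O) :
    ForcingDense (closureInside O) := by
  intro U
  obtain ⟨x, hxU, hxO⟩ := hd.inter_open_nonempty _ U.1.isOpen U.2
  obtain ⟨ε, hε, hb⟩ := Metric.nhds_basis_closedBall.mem_iff.1
    ((U.1.isOpen.inter ho).mem_nhds ⟨hxU, hxO⟩)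
  refine ⟨⟨⟨Metric.ball x ε, Metric.isOpen_ball⟩, x, Metric.mem_ball_self hε⟩, ?_, ?_⟩
  · exact Metric.closure_ball_subset_closedBall.trans (hb.trans inter_subset_right)
  · exact Metric.ball_subset_closedBall.trans (hb.trans inter_subset_left)

theorem forcingDense_smallOpens (n : ℕ) : ForcingDense (smallOpens n) := by
  intro U
  obtain ⟨x, hx⟩ := U.2
  refine ⟨⟨⟨U.1 ∩ Metric.ball x (1 / (n + 1)), U.1.isOpen.inter Metric.isOpen_ball⟩,
    x, hx, Metric.mem_ball_self (by positivity)⟩, ⟨x, inter_subset_right⟩, ?_⟩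
  exact inter_subset_left (s := (U.1 : Set EllTwo))

/-- Members of a filter of nonempty open sets meet pairwise. Meeting every `smallOpens n` makes the
centres of the balls Cauchy, and their limit lies in the closure of every member; meeting the sets
`closureInside` then puts it in each prescribed dense open set. -/
theorem comeagerIntersection_of_martinsAxiom (h : MartinsAxiom) : ComeagerIntersection := by
  intro 𝒞 hcard hres
  have hO : ∀ C : 𝒞, ∃ O : ℕ → Set EllTwo,
      (∀ n, IsOpen (O n)) ∧ (∀ n, Dense (O n)) ∧ ⋂ n, O n ⊆ C := by
    intro C
    obtain ⟨t, htC, hG, hd⟩ := mem_residual.1 (hres C C.2)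
    obtain ⟨O, hO, rfl⟩ := isGδ_iff_eq_iInter_nat.1 hG
    exact ⟨O, hO, fun n => hd.mono (iInter_subset _ n), htC⟩
  choose O hOo hOd hOC using hO
  have : Nonempty NonemptyOpens := ⟨⟨⊤, ⟨0, trivial⟩⟩⟩
  let D : (𝒞 × ℕ) ⊕ ℕ → Set NonemptyOpens :=
    Sum.elim (fun p => closureInside (O p.1 p.2)) smallOpens
  have hD : #(range D) < 𝔠 := by
    refine Cardinal.mk_range_le.trans_lt ?_
    rw [Cardinal.mk_sum, Cardinal.mk_prod]
    simp only [Cardinal.lift_id, Cardinal.mk_nat]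
    have := Cardinal.aleph0_lt_continuum
    exact Cardinal.add_lt_of_lt Cardinal.aleph0_le_continuum
      (Cardinal.mul_lt_of_lt Cardinal.aleph0_le_continuum hcard this) this
  obtain ⟨G, hG, hGD⟩ := h NonemptyOpens ccc_nonemptyOpens (range D) hD (by
    rintro _ ⟨p | n, rfl⟩
    · exact forcingDense_closureInside (hOo p.1 p.2) (hOd p.1 p.2)
    · exact forcingDense_smallOpens n)
  have hcomp : ∀ U ∈ G, ∀ V ∈ G, ((U.1 : Set EllTwo) ∩ V.1).Nonempty := fun U hU V hV => by
    obtain ⟨W, -, hWU, hWV⟩ := hG.toPFilter.directed U hU V hV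
    exact W.2.mono (subset_inter hWU hWV)
  have hsmall (n : ℕ) : ∃ U ∈ G, ∃ x, (U.1 : Set EllTwo) ⊆ Metric.ball x (1 / (n + 1)) :=
    hGD _ ⟨Sum.inr n, rfl⟩
  choose S hSG u hu using hsmall
  have hlim : Tendsto (fun n : ℕ => (1 / (n + 1) : ℝ)) atTop (𝓝 0) :=
    tendsto_one_div_add_atTop_nhds_zero_nat
  have hcau : CauchySeq u := by
    refine cauchySeq_of_le_tendsto_0 (fun n : ℕ => (2 * (1 / (n + 1)) : ℝ)) (fun n m N hn hm => ?_)
      (by simpa using hlim.const_mul 2)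
    obtain ⟨p, hpn, hpm⟩ := hcomp _ (hSG n) _ (hSG m)
    have h1 := Metric.mem_ball.1 (hu n hpn)
    have h2 := Metric.mem_ball.1 (hu m hpm)
    have h3 : (1 / (n + 1) : ℝ) ≤ 1 / (N + 1) := by gcongr
    have h4 : (1 / (m + 1) : ℝ) ≤ 1 / (N + 1) := by gcongr
    linarith [dist_triangle_left (u n) (u m) p]
  obtain ⟨x, hx⟩ := cauchySeq_tendsto_of_complete hcau
  have hxcl : ∀ U ∈ G, x ∈ closure (U.1 : Set EllTwo) := by
    intro U hU
    choose q hqU hqS using fun n => hcomp U hU _ (hSG n)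
    refine mem_closure_of_tendsto (f := q) (b := atTop) ?_ (Eventually.of_forall hqU)
    refine tendsto_of_tendsto_of_dist hx
      (squeeze_zero (fun _ => dist_nonneg) (fun n => ?_) hlim)
    rw [dist_comm]
    exact (Metric.mem_ball.1 (hu n (hqS n))).le
  refine ⟨x, fun C hC => hOC ⟨C, hC⟩ (mem_iInter.2 fun n => ?_)⟩
  obtain ⟨U, hUG, hU⟩ := hGD _ ⟨Sum.inl (⟨C, hC⟩, n), rfl⟩
  exact hU (hxcl U hUG)

/-! ### The Bernstein-type recursion -/

/-- Under `ComeagerIntersection`, fewer than continuum many comeager sets have dense intersection: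
a common point of all their translates by a countable dense set has a translate in any open set. -/
theorem ComeagerIntersection.dense_sInter (h : ComeagerIntersection) {𝒞 : Set (Set EllTwo)}
    (hcard : #𝒞 < 𝔠) (hres : ∀ C ∈ 𝒞, C ∈ residual EllTwo) : Dense (⋂₀ 𝒞) := by
  rw [dense_iff_inter_open]
  rintro U hU ⟨u, hu⟩
  let d := TopologicalSpace.denseSeq EllTwo
  let T : 𝒞 × ℕ → Set EllTwo := fun p => (fun x => x - d p.2) ⁻¹' p.1
  obtain ⟨x, hx⟩ := h (range T)
    (Cardinal.mk_range_le.trans_lt (by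
      rw [Cardinal.mk_prod]
      simp only [Cardinal.lift_id, Cardinal.mk_nat]
      exact Cardinal.mul_lt_of_lt Cardinal.aleph0_le_continuum hcard
        Cardinal.aleph0_lt_continuum))
    (by
      rintro _ ⟨p, rfl⟩
      exact tendsto_residual_of_isOpenMap (Homeomorph.subRight (d p.2)).continuous
        (Homeomorph.subRight (d p.2)).isOpenMap (hres _ p.1.2))
  have hopen : IsOpen ((fun e => x - e) ⁻¹' U) := hU.preimage (continuous_const.sub continuous_id)
  obtain ⟨n, hn⟩ := (TopologicalSpace.denseRange_denseSeq EllTwo).exists_mem_open hopen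
    ⟨x - u, by simpa using hu⟩
  exact ⟨x - d n, hn, fun C hC => hx _ ⟨(⟨C, hC⟩, n), rfl⟩⟩

theorem ComeagerIntersection.dense_iInter (h : ComeagerIntersection) {ι : Type} (hι : #ι < 𝔠)
    {C : ι → Set EllTwo} (hC : ∀ i, C i ∈ residual EllTwo) : Dense (⋂ i, C i) := by
  rw [← sInter_range]
  refine h.dense_sInter (Cardinal.mk_range_le.trans_lt hι) ?_
  rintro _ ⟨i, rfl⟩
  exact hC i

/-- The set contains a relatively comeager subset of a nonempty open set. -/
def LocallyComeager (t : Set EllTwo) : Prop :=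
  ∃ U : Set EllTwo, IsOpen U ∧ U.Nonempty ∧ ∃ C ∈ residual EllTwo, C ∩ U ⊆ t

/-- The locally comeager Borel subsets of `ℓ²`. -/
abbrev LocallyComeagerBorel : Type :=
  {t : Set EllTwo // @MeasurableSet _ (borel EllTwo) t ∧ LocallyComeager t}

theorem mk_locallyComeagerBorel_le : #LocallyComeagerBorel ≤ 𝔠 := by
  have h := MeasurableSpace.cardinal_measurableSet_le_continuum
    ((Cardinal.le_aleph0_iff_set_countable.2
      (TopologicalSpace.countable_countableBasis EllTwo)).trans Cardinal.aleph0_le_continuum)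
  rw [← (TopologicalSpace.isBasis_countableBasis EllTwo).borel_eq_generateFrom] at h
  exact (Cardinal.mk_subtype_mono fun _ ht => ht.1).trans h

/-- A set meeting all locally comeager Borel sets but containing none of them does not have the
property of Baire. -/
theorem not_baireMeasurableSet_of_bernstein {H : Set EllTwo}
    (h₁ : ∀ t : LocallyComeagerBorel, (t.1 ∩ H).Nonempty)
    (h₂ : ∀ t : LocallyComeagerBorel, (t.1 \ H).Nonempty) : ¬ BaireMeasurableSet H := by
  intro hH
  obtain ⟨U, hU, hHU⟩ := hH.residualEq_isOpen
  obtain ⟨G, hGH, hG, hGd⟩ := mem_residual.1 (eventuallyEq_set.1 hHU)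
  borelize EllTwo
  have hGr := residual_of_dense_Gδ hG hGd
  -- On the comeager set `G`, `H` coincides with `U`: either `G` misses `H`, or `G ∩ U` is a locally
  -- comeager Borel set inside `H`.
  rcases U.eq_empty_or_nonempty with rfl | hUn
  · obtain ⟨x, hxG, hxH⟩ := h₁ ⟨G, hG.measurableSet, univ, isOpen_univ, univ_nonempty, G, hGr,
      inter_subset_left⟩
    exact (hGH hxG).1 hxH
  · obtain ⟨x, ⟨hxG, hxU⟩, hxH⟩ := h₂ ⟨G ∩ U, hG.measurableSet.inter hU.measurableSet, U, hU, hUn,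
      G, hGr, Subset.rfl⟩
    exact hxH ((hGH hxG).2 hxU)

/-- The vectors that are hypercyclic for all weights in `{1,2}^ω` that are eventually `2`. -/
def commonHC : Set EllTwo := {x | ∀ A : Finset ℕ, x ∈ HC (weightOf (A : Set ℕ)ᶜ)}

theorem commonHC_mem_residual : commonHC ∈ residual EllTwo := by
  rw [commonHC, ofPred_forall, countable_iInter_mem]
  exact fun A => HC_weightOf_mem_residual (tendsto_partialProd_compl_finset A)

/-- The vectors whose attached weight sequence has a generic set of hypercyclic vectors. -/
def genericAvoiding : Set EllTwo := {y | HC (weightOf (avoidSet y)) ∈ residual EllTwo}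

theorem genericAvoiding_mem_residual : genericAvoiding ∈ residual EllTwo := by
  obtain ⟨x, hx⟩ := (dense_of_mem_residual commonHC_mem_residual).nonempty
  filter_upwards [residual_mem_HC_avoidSet hx] with y hy
  exact HC_weightOf_mem_residual_of_nonempty ⟨x, hy⟩

/-- One stage of the recursion. The vector `x` is chosen first, against the earlier `y`'s, whose
`HC` sets are comeager by `genericAvoiding`; then `y` is chosen against the earlier `x`'s and the
new one, all in `commonHC`. -/
theorem exists_pair (h : ComeagerIntersection) (t : LocallyComeagerBorel) {ι : Type}
    (hι : #ι < 𝔠) (v : ι → commonHC × genericAvoiding) :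
    ∃ p : commonHC × genericAvoiding, p.1.1 ∈ t.1 ∧ p.2.1 ∈ t.1 ∧
      (∀ i, p.1.1 ∈ HC (weightOf (avoidSet (v i).2))) ∧
      p.1.1 ∈ HC (weightOf (avoidSet p.2)) ∧
      ∀ i, (v i).1.1 ∈ HC (weightOf (avoidSet p.2)) := by
  obtain ⟨t, -, U, hU, hUn, C, hC, hCU⟩ := t
  -- The extra index `none` carries the conditions not coming from earlier stages.
  have hopt : #(Option ι) < 𝔠 := by
    rw [Cardinal.mk_option]
    exact Cardinal.add_lt_of_lt Cardinal.aleph0_le_continuum hι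
      (Cardinal.one_lt_aleph0.trans Cardinal.aleph0_lt_continuum)
  obtain ⟨x, hxU, hx⟩ := (h.dense_iInter hopt
    (C := fun o => o.elim (C ∩ commonHC) fun i => HC (weightOf (avoidSet (v i).2)))
    (by
      rintro (_ | i)
      · exact inter_mem hC commonHC_mem_residual
      · exact (v i).2.2)).inter_open_nonempty U hU hUn
  rw [mem_iInter] at hx
  have hx0 : x ∈ commonHC := (hx none).2
  obtain ⟨y, hyU, hy⟩ := (h.dense_iInter hopt
    (C := fun o => o.elim ((C ∩ genericAvoiding) ∩ {y | x ∈ HC (weightOf (avoidSet y))})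
      fun i => {y | (v i).1.1 ∈ HC (weightOf (avoidSet y))})
    (by
      rintro (_ | i)
      · exact inter_mem (inter_mem hC genericAvoiding_mem_residual) (residual_mem_HC_avoidSet hx0)
      · exact residual_mem_HC_avoidSet (v i).1.2)).inter_open_nonempty U hU hUn
  rw [mem_iInter] at hy
  exact ⟨⟨⟨x, hx0⟩, y, (hy none).1.2⟩, hCU ⟨(hx none).1, hxU⟩, hCU ⟨(hy none).1.1, hyU⟩,
    fun i => hx (some i), (hy none).2, fun i => hy (some i)⟩

theorem exists_not_baireMeasurableSet (h : ComeagerIntersection) :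
    ∃ W ⊆ oneTwoSequences, ¬ BaireMeasurableSet (HCStar W) := by
  -- A well-order of least possible type has proper initial segments of smaller cardinality, hence
  -- below `𝔠`.
  obtain ⟨r, hr, hord⟩ := Cardinal.exists_ord_eq LocallyComeagerBorel
  have hlt (t : LocallyComeagerBorel) : #{s // r s t} < 𝔠 :=
    (Cardinal.card_typein_lt t hord).trans_le mk_locallyComeagerBorel_le
  let F : LocallyComeagerBorel → commonHC × genericAvoiding :=
    hr.wf.fix fun t v => (exists_pair h t (hlt t) fun s => v s.1 s.2).choose
  have hF (t : LocallyComeagerBorel) : (F t).1.1 ∈ t.1 ∧ (F t).2.1 ∈ t.1 ∧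
      (∀ s : {s // r s t}, (F t).1.1 ∈ HC (weightOf (avoidSet (F s.1).2))) ∧
      (F t).1.1 ∈ HC (weightOf (avoidSet (F t).2)) ∧
      ∀ s : {s // r s t}, (F s.1).1.1 ∈ HC (weightOf (avoidSet (F t).2)) := by
    have heq : F t = (exists_pair h t (hlt t) fun s => F s.1).choose := hr.wf.fix_eq _ t
    rw [heq]
    exact (exists_pair h t (hlt t) fun s => F s.1).choose_spec
  refine ⟨range fun t => weightOf (avoidSet (F t).2), ?_,
    not_baireMeasurableSet_of_bernstein (fun t => ⟨(F t).1, (hF t).1, ?_⟩)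
      fun t => ⟨(F t).2, (hF t).2.1, fun hy => ?_⟩⟩
  · rintro _ ⟨t, rfl⟩
    exact weightOf_mem_oneTwoSequences _
  · simp only [HCStar, biInter_range, mem_iInter]
    intro s
    -- The later of the two stages secured the relation between `x_t` and `y_s`.
    rcases trichotomous_of r s t with hst | rfl | hts
    · exact (hF t).2.2.1 ⟨s, hst⟩
    · exact (hF s).2.2.2.1
    · exact (hF s).2.2.2.2 ⟨t, hts⟩
  · simp only [HCStar, biInter_range, mem_iInter] at hy
    exact notMem_HC_avoidSet _ (hy t)

end CommonHypercyclic

theorem theorem3 :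
    (CommonHypercyclic.MartinsAxiom →
      ∃ W ⊆ CommonHypercyclic.oneTwoSequences,
        ¬ BaireMeasurableSet (CommonHypercyclic.HCStar W)) ∧
    (CommonHypercyclic.ContinuumHypothesis →
      ∃ W ⊆ CommonHypercyclic.oneTwoSequences,
        ¬ BaireMeasurableSet (CommonHypercyclic.HCStar W)) ∧
    (CommonHypercyclic.ComeagerIntersection →
      ∃ W ⊆ CommonHypercyclic.oneTwoSequences,
        ¬ BaireMeasurableSet (CommonHypercyclic.HCStar W)) := by
  open CommonHypercyclic in
  exact ⟨fun h => exists_not_baireMeasurableSet (comeagerIntersection_of_martinsAxiom h),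
    fun h => exists_not_baireMeasurableSet (comeagerIntersection_of_continuumHypothesis h),
    exists_not_baireMeasurableSet⟩
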